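/- Let $d\in\{2,3\}$, let $\mathcal G=(\mathcal V,\mathcal E)$ be a finite simple undirected graph on $\mathcal V=\{1,\dots,n\}$ with $m$ edges, numbered $1,\dots,m$ and directed arbitrarily, and let $H\in\mathbb R^{m\times n}$ be its incidence matrix ($h_{ki}=1$ if edge $k$ sinks at $i$, $h_{ki}=-1$ if edge $k$ leaves $i$, and $h_{ki}=0$ otherwise). For $p=[p_1^T,\dots,p_n^T]^T\in\mathbb R^{dn}$ put $z=(H\otimes I_d)p$, $Z=\mathrm{diag}(z_1,\dots,z_m)\in\mathbb R^{dm\times m}$ and $R(p)=Z^T(H\otimes I_d)$ (the rigidity matrix). The framework $(\mathcal G,p)$ is called infinitesimally rigid in $\mathbb R^d$ if $n\ge d$ and $\operatorname{rank}R(p)=dn-d(d+1)/2$. Let $\mathcal G_o=(\mathcal V,\mathcal E_o)$ be the graph of orientation edges, $L_o$ its Laplacian matrix, let $d_1,\dots,d_m$ be desired distances of the edges of $\mathcal G$, and let $\hat p\in\mathbb R^{dn}$. Let $\tilde p\in\mathbb R^{dn}$ be a target formation, i.e. $\|\tilde p_i-\tilde p_j\|=d_k$ for every edge $k=(i,j)\in\mathcal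 E$ and $\tilde p_i-\tilde p_j=\hat p_i-\hat p_j$ for all $(i,j)\in\mathcal E_o$. Assume that $(\mathcal G,\tilde p)$ is infinitesimally rigid and that the orientation edges are chosen as follows: if $d=2$, $\mathcal E_o$ consists of one edge $(i,j)\in\mathcal E$ with $\tilde p_j\ne\tilde p_i$; if $d=3$, $\mathcal E_o$ consists of two edges $(i,j),(i,k)\in\mathcal E$ with a common endpoint $i$ for which $\tilde p_j-\tilde p_i$ and $\tilde p_k-\tilde p_i$ are linearly independent. Consider the closed-loop system $$\dot p=-R(p)^Te(p)-(L_o\otimes I_d)\,\bar p,$$ where $e_k(p)=\|p_i-p_j\|^2-d_k^2$ for each edge $k=(i,j)$, $\bar p_i=p_i-\hat p_i$ if $i$ is an endpoint of an edge in $\mathcal E_o$, and $\bar p_i=0$ otherwise. Let $$\mathcal M=\{p\in\mathbb R^{dn}: e(p)=0,\ p_i-p_j=\hat p_i-\hat p_j\ \ \forall (i,j)\in\mathcal E_o\}$$ be the set of desired equilibria. Then the matrix $\mathcal F=R(\tilde p)^TR(\tilde p)+L_o\otimes I_d$ has a smallest positive eigenvalue $\gamma$, and there are constants $\delta>0$ and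 $C>0$ such that for every initial configuration $p_0\in\mathbb R^{dn}$ with $\|p_0-(\tilde p+\mathbf 1_n\otimes c)\|<\delta$ for some $c\in\mathbb R^d$ (in particular whenever $\|p_0-\tilde p\|<\delta$) the closed-loop system has a solution on $[0,\infty)$ with $p(0)=p_0$, and every such solution converges exponentially with rate $\gamma$ to a desired equilibrium with the shape and orientation of the target: there is $p^*\in\mathcal M$ of the form $p^*=\tilde p+\mathbf 1_n\otimes c^*$ with $c^*\in\mathbb R^d$ such that $$\|p(t)-p^*\|\le C\,\|p_0-p^*\|\,e^{-\gamma t}\qquad\text{for all }t\ge 0 .$$ -/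

import Mathlib

open scoped Kronecker

noncomputable section

namespace Formation

/-- A stacked configuration `p = [p₁ᵀ, …, pₙᵀ]ᵀ ∈ ℝ^{dn}` with its Euclidean norm; the entry
`(i, a)` is the `a`-th coordinate of agent `i`. -/
abbrev Config (n d : ℕ) : Type := EuclideanSpace ℝ (Fin n × Fin d)

/-- The position `p_i ∈ ℝ^d` of agent `i`. -/
def agent {n d : ℕ} (p : Config n d) (i : Fin n) : EuclideanSpace ℝ (Fin d) :=
  WithLp.toLp 2 fun a => p (i, a)

/-- The configuration `p + 1ₙ ⊗ c`, all agents being shifted by the same vector `c`. -/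
def translate {n d : ℕ} (p : Config n d) (c : EuclideanSpace ℝ (Fin d)) : Config n d :=
  WithLp.toLp 2 fun ia => p ia + c ia.2

/-- A numbering of the edges of the undirected graph `G` by `1, …, m`, each edge being given an
arbitrary direction from its tail to its head. -/
structure EdgeLabelling {n : ℕ} (G : SimpleGraph (Fin n)) (m : ℕ) where
  tail : Fin m → Fin n
  head : Fin m → Fin n
  bijOn : Set.BijOn (fun k => s(tail k, head k)) Set.univ G.edgeSet

section Shape

variable {n d m : ℕ} {G : SimpleGraph (Fin n)}

/-- The incidence matrix `H ∈ ℝ^{m×n}`. -/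
def incidence (E : EdgeLabelling G m) : Matrix (Fin m) (Fin n) ℝ :=
  Matrix.of fun k i => if i = E.head k then 1 else if i = E.tail k then -1 else 0

/-- The stacked relative positions `z = (H ⊗ I_d) p`, so that `z_k = p_{head k} - p_{tail k}`. -/
def relPos (E : EdgeLabelling G m) (p : Config n d) : Fin m × Fin d → ℝ :=
  (incidence E ⊗ₖ (1 : Matrix (Fin d) (Fin d) ℝ)).mulVec p.ofLp

/-- The block diagonal matrix `Z(z) = diag(z₁, …, z_m) ∈ ℝ^{dm×m}`. -/
def blockDiag (z : Fin m × Fin d → ℝ) : Matrix (Fin m × Fin d) (Fin m) ℝ :=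
  Matrix.of fun ka l => if ka.1 = l then z ka else 0

/-- The rigidity matrix `R(p) = Z(z)ᵀ (H ⊗ I_d) ∈ ℝ^{m×dn}`. -/
def rigidityMatrix (E : EdgeLabelling G m) (p : Config n d) :
    Matrix (Fin m) (Fin n × Fin d) ℝ :=
  (blockDiag (relPos E p)).transpose * (incidence E ⊗ₖ (1 : Matrix (Fin d) (Fin d) ℝ))

/-- Infinitesimal rigidity of the framework `(G, p)` in `ℝ^d`:
`n ≥ d` and `rank R(p) = dn - d(d+1)/2` (written without truncated subtraction). -/
def InfinitesimallyRigid (E : EdgeLabelling G m) (p : Config n d) : Prop :=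
  d ≤ n ∧ (rigidityMatrix E p).rank + d * (d + 1) / 2 = d * n

/-- The vector `e` of squared distance errors `e_k = ‖p_i - p_j‖² - d_k²`. -/
def distError (E : EdgeLabelling G m) (dist : Fin m → ℝ) (p : Config n d) : Fin m → ℝ :=
  fun k => ‖agent p (E.head k) - agent p (E.tail k)‖ ^ 2 - dist k ^ 2

end Shape

section Orientation

variable {n d m : ℕ} {G : SimpleGraph (Fin n)}

/-- The admissible choices of the orientation graph `Go`, relative to the positions `p`.
In the plane: one edge of `G`, with nonzero relative position vector.
In space: two edges of `G` at a common agent `i`, whose relative position vectors do not lie on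
one line (are linearly independent). -/
def IsOrientationChoice (G Go : SimpleGraph (Fin n)) (p : Config n d) : Prop :=
  (d = 2 ∧ ∃ i j, G.Adj i j ∧ agent p j - agent p i ≠ 0 ∧
    Go = SimpleGraph.fromEdgeSet {s(i, j)}) ∨
  (d = 3 ∧ ∃ i j k, G.Adj i j ∧ G.Adj i k ∧
    LinearIndependent ℝ ![agent p j - agent p i, agent p k - agent p i] ∧
    Go = SimpleGraph.fromEdgeSet {s(i, j), s(i, k)})

/-- `p` is a target formation: the distance constraints `‖p_i - p_j‖ = d_k` on all edges of `G`
and the orientation constraints `p_i - p_j = p̂_i - p̂_j` on all edges of `Go`. -/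
def IsTarget (E : EdgeLabelling G m) (Go : SimpleGraph (Fin n)) (dist : Fin m → ℝ)
    (pHat p : Config n d) : Prop :=
  (∀ k, ‖agent p (E.tail k) - agent p (E.head k)‖ = dist k) ∧
  ∀ i j, Go.Adj i j → agent p i - agent p j = agent pHat i - agent pHat j

/-- The set `M` of desired equilibria. -/
def desiredSet (E : EdgeLabelling G m) (Go : SimpleGraph (Fin n)) (dist : Fin m → ℝ)
    (pHat : Config n d) : Set (Config n d) :=
  {p | distError E dist p = 0 ∧
    ∀ i j, Go.Adj i j → agent p i - agent p j = agent pHat i - agent pHat j}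

/-- The vector `p̄`: `p̄_i = p_i - p̂_i` for orientation agents (the endpoints of edges of `Go`),
and `p̄_i = 0` for all other agents. -/
def pBar (Go : SimpleGraph (Fin n)) [DecidableRel Go.Adj] (pHat p : Config n d) :
    Fin n × Fin d → ℝ :=
  fun ia => if ∃ j, Go.Adj ia.1 j then p ia - pHat ia else 0

/-- The matrix `L_o ⊗ I_d`, with `L_o` the Laplacian matrix of `Go`. -/
def orientationMatrix (d : ℕ) (Go : SimpleGraph (Fin n)) [DecidableRel Go.Adj] :
    Matrix (Fin n × Fin d) (Fin n × Fin d) ℝ :=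
  Go.lapMatrix ℝ ⊗ₖ (1 : Matrix (Fin d) (Fin d) ℝ)

/-- The right-hand side `-R(p)ᵀ e(p) - (L_o ⊗ I_d) p̄` of the closed-loop system. -/
def closedLoop (E : EdgeLabelling G m) (Go : SimpleGraph (Fin n)) [DecidableRel Go.Adj]
    (dist : Fin m → ℝ) (pHat p : Config n d) : Config n d :=
  WithLp.toLp 2
    (-((rigidityMatrix E p).transpose.mulVec (distError E dist p))
      - (orientationMatrix d Go).mulVec (pBar Go pHat p))

/-- `p` is a solution on `[0, ∞)` of the closed-loop system with `p(0) = p₀`. -/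
def IsSolution (E : EdgeLabelling G m) (Go : SimpleGraph (Fin n)) [DecidableRel Go.Adj]
    (dist : Fin m → ℝ) (pHat p₀ : Config n d) (p : ℝ → Config n d) : Prop :=
  p 0 = p₀ ∧
  ∀ t ∈ Set.Ici (0 : ℝ),
    HasDerivWithinAt p (closedLoop E Go dist pHat (p t)) (Set.Ici 0) t

/-- The matrix `F = R(p)ᵀ R(p) + L_o ⊗ I_d`. -/
def matrixF (E : EdgeLabelling G m) (Go : SimpleGraph (Fin n)) [DecidableRel Go.Adj]
    (p : Config n d) : Matrix (Fin n × Fin d) (Fin n × Fin d) ℝ :=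
  (rigidityMatrix E p).transpose * rigidityMatrix E p + orientationMatrix d Go

/-- `γ` is the smallest positive eigenvalue of the square matrix `A`. -/
def IsSmallestPosEigenvalue {ι : Type*} [Fintype ι] [DecidableEq ι]
    (A : Matrix ι ι ℝ) (γ : ℝ) : Prop :=
  IsLeast {μ : ℝ | 0 < μ ∧ Module.End.HasEigenvalue (Matrix.toLin' A) μ} γ

end Orientation

end Formation

end

/-! Write a configuration as `p̃ + 1 ⊗ c + x`, with `c` chosen so that `x` is orthogonal to all
translations. The closed loop preserves the centroid (`closedLoop_mem_orthogonal`), so `x` stays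
orthogonal to them, and the limit `p̃ + 1 ⊗ c` is determined by `p₀` alone.

Positivity: `ker F = ker R(p̃) ∩ ker L`, where `L = L_o ⊗ I_d`. Rigidity gives `dim ker R(p̃) =
d(d+1)/2`. The infinitesimal rotations lie in this kernel, and the orientation edges ensure that no
nonzero one lies in `ker L`. Counting dimensions leaves exactly the translations in `ker F`
(`exists_eq_translation_of_mulVec_eq_zero`), whence `xᵀFx ≥ γ‖x‖²` for the admissible `x`.

Nonlinear estimate (`inner_closedLoop_le`): with `a = R(p̃)x` and `b_k` the squared length of the
`k`-th relative position in `x`, one has `R(p)x = a + b` and `e(p) = 2a + b`. One of the two copies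
of `‖a‖²` in `(a + b)·(2a + b)` is kept for `F`; the other absorbs the cubic term, leaving a quartic
error. So `V = ‖x‖²` satisfies `V' ≤ -2γV + 2KV²`, with `K` independent of `c`. Comparison with this
logistic equation gives the exact rate `γ` (`norm_le_exp_of_inner_le`). The same inequality traps
solutions in a ball, which gives global existence. -/

/-! ### Global solutions of bounded Lipschitz fields -/

open Set Metric in
/-- A bounded globally Lipschitz autonomous vector field has global integral curves. -/
theorem exists_global_solution_of_lipschitz_of_bounded {F : Type*} [NormedAddCommGroup F]
    [NormedSpace ℝ F] [CompleteSpace F] {v : F → F} {K L : NNReal} (hv : LipschitzWith K v)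
    (hL : ∀ x, ‖v x‖ ≤ L) (x₀ : F) :
    ∃ α : ℝ → F, α 0 = x₀ ∧ ∀ t, HasDerivAt α (v (α t)) t := by
  have local_sol : ∀ N : ℕ, ∃ α : ℝ → F, α 0 = x₀ ∧
      ∀ t ∈ Ioo (-(N + 1 : ℝ)) (N + 1), HasDerivAt α (v (α t)) t := by
    intro N
    have hN : (0 : ℝ) ≤ N + 1 := by positivity
    -- A field bounded by `L` moves a point by at most `L * (N + 1)` in time `N + 1`, so a ball of
    -- that radius always suffices.
    have hpl : IsPicardLindelof (fun _ => v) (tmin := -(N + 1 : ℝ)) (tmax := N + 1)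
        ⟨0, by linarith, hN⟩ x₀ (L * (N + 1)) 0 L K :=
      .of_time_independent (fun x _ => hL x) hv.lipschitzOnWith (by simp)
    obtain ⟨α, h0, hα⟩ := hpl.exists_eq_forall_mem_Icc_hasDerivWithinAt₀
    exact ⟨α, h0, fun t ht => (hα t (Ioo_subset_Icc_self ht)).hasDerivAt (Icc_mem_nhds ht.1 ht.2)⟩
  choose α h0 hα using local_sol
  have agree : ∀ M N : ℕ, M ≤ N → EqOn (α M) (α N) (Ioo (-(M + 1 : ℝ)) (M + 1)) := by
    intro M N hMN
    have hMN' : (M : ℝ) ≤ N := by exact_mod_cast hMN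
    have hM : (0 : ℝ) ≤ M := M.cast_nonneg
    refine ODE_solution_unique_of_mem_Ioo (v := fun _ => v) (s := fun _ => univ) (t₀ := 0) (K := K)
      (fun t _ => hv.lipschitzOnWith) ⟨by linarith, by linarith⟩
      (fun t ht => ⟨hα M t ht, mem_univ _⟩)
      (fun t ht => ⟨hα N t ⟨by linarith [ht.1], by linarith [ht.2]⟩, mem_univ _⟩) (by rw [h0, h0])
  have floor_mem : ∀ t : ℝ, t ∈ Ioo (-((⌊|t|⌋₊ : ℝ) + 1)) (⌊|t|⌋₊ + 1) := fun t =>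
    abs_lt.mp (Nat.lt_floor_add_one |t|)
  have glue : ∀ (N : ℕ), ∀ t ∈ Ioo (-(N + 1 : ℝ)) (N + 1), α ⌊|t|⌋₊ t = α N t := by
    intro N t ht
    refine agree _ _ ?_ (floor_mem t)
    have : |t| < (N + 1 : ℕ) := by push_cast; exact abs_lt.mpr ht
    exact Nat.lt_succ_iff.mp ((Nat.floor_lt (abs_nonneg t)).mpr this)
  -- The index `⌊|t|⌋₊` gives an open interval containing `t`; near `t` the glued curve coincides
  -- with that single local solution.
  refine ⟨fun t => α ⌊|t|⌋₊ t, by simp [h0], fun t => ?_⟩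
  have ht := floor_mem t
  refine (hα _ t ht).congr_of_eventuallyEq ?_
  filter_upwards [Ioo_mem_nhds ht.1 ht.2] with s hs using glue _ s hs

/-! ### Invariance, decay and forward existence -/

section Lyapunov

open Set
open scoped RealInnerProductSpace

variable {F : Type*} [NormedAddCommGroup F] [InnerProductSpace ℝ F]

/-- A curve whose velocity lies in a subspace `S` stays in `S` if it starts there. -/
theorem mem_submodule_of_hasDerivWithinAt {S : Submodule ℝ F} [FiniteDimensional ℝ F]
    {x x' : ℝ → F} (hx : ∀ t ∈ Ici (0 : ℝ), HasDerivWithinAt x (x' t) (Ici 0) t)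
    (hx' : ∀ t ∈ Ici (0 : ℝ), x' t ∈ S) (h0 : x 0 ∈ S) {t : ℝ} (ht : 0 ≤ t) : x t ∈ S := by
  rw [← Submodule.orthogonal_orthogonal S, Submodule.mem_orthogonal]
  intro u hu
  have hder : ∀ s ∈ Ici (0 : ℝ), HasDerivWithinAt (fun s => ⟪u, x s⟫) 0 (Ici 0) s := by
    intro s hs
    have := (hasDerivWithinAt_const s (Ici 0) u).inner ℝ (hx s hs)
    simpa [Submodule.inner_left_of_mem_orthogonal (hx' s hs) hu] using this
  have hc := constant_of_has_deriv_right_zero (a := 0) (b := t) (f := fun s => ⟪u, x s⟫)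
    (fun s hs => ((hder s hs.1).continuousWithinAt).mono Icc_subset_Ici_self)
    (fun s hs => (hder s hs.1).mono (Ici_subset_Ici.mpr hs.1)) t ⟨ht, le_rfl⟩
  rw [hc]
  exact Submodule.inner_left_of_mem_orthogonal h0 hu

/-- If a vector field points inwards along a sphere, solutions starting in the ball stay in it. -/
theorem norm_sq_le_of_inner_neg {x x' : ℝ → F} {c : ℝ}
    (hx : ∀ t ∈ Ici (0 : ℝ), HasDerivWithinAt x (x' t) (Ici 0) t)
    (hin : ∀ t ∈ Ici (0 : ℝ), ‖x t‖ ^ 2 = c → ⟪x t, x' t⟫ < 0) (h0 : ‖x 0‖ ^ 2 ≤ c)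
    {t : ℝ} (ht : 0 ≤ t) : ‖x t‖ ^ 2 ≤ c := by
  refine image_le_of_deriv_right_lt_deriv_boundary (a := 0) (b := t) (B := fun _ => c)
    (B' := fun _ => 0) (f' := fun s => 2 * ⟪x s, x' s⟫)
    (fun s hs => ((hx s hs.1).norm_sq.continuousWithinAt).mono Icc_subset_Ici_self)
    (fun s hs => (hx s hs.1).norm_sq.mono (Ici_subset_Ici.mpr hs.1)) h0
    (fun s => hasDerivAt_const s c) (fun s hs he => ?_) ⟨ht, le_rfl⟩
  linarith [hin s hs.1 he]

/-- The differential inequality `V' ≤ -2γV + 2KV²` for the squared norm `V`, started at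
`V ≤ γ / (2K)`, forces decay with the exact rate `γ`. -/
theorem norm_le_exp_of_inner_le {x x' : ℝ → F} {γ K : ℝ} (hγ : 0 < γ) (hK : 0 < K)
    (hx : ∀ t ∈ Ici (0 : ℝ), HasDerivWithinAt x (x' t) (Ici 0) t)
    (hin : ∀ t ∈ Ici (0 : ℝ), ⟪x t, x' t⟫ ≤ -γ * ‖x t‖ ^ 2 + K * ‖x t‖ ^ 4)
    (h0 : ‖x 0‖ ^ 2 ≤ γ / (2 * K)) {t : ℝ} (ht : 0 ≤ t) :
    ‖x t‖ ≤ √2 * ‖x 0‖ * Real.exp (-γ * t) := by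
  have hc : 0 < γ / (2 * K) := by positivity
  have hV : ∀ s, 0 ≤ s → ‖x s‖ ^ 2 ≤ γ / (2 * K) := by
    intro s hs
    refine norm_sq_le_of_inner_neg hx (fun s hs he => (hin s hs).trans_lt ?_) h0 hs
    have h4 : ‖x s‖ ^ 4 = (‖x s‖ ^ 2) ^ 2 := by ring
    have : -γ * (γ / (2 * K)) + K * (γ / (2 * K)) ^ 2 = -(γ * γ / (4 * K)) := by
      field_simp; ring
    rw [h4, he, this]
    have : 0 < γ * γ / (4 * K) := by positivity
    linarith
  have hden : ∀ s, 0 ≤ s → γ / 2 ≤ γ - K * ‖x s‖ ^ 2 := by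
    intro s hs
    have := (le_div_iff₀ (by positivity)).mp (hV s hs)
    linarith
  -- `exp(2γs) V / (γ - KV)` is a first integral of `V' = -2γV + 2KV²`; under the inequality it is
  -- nonincreasing.
  let U : ℝ → ℝ := fun s => Real.exp (2 * γ * s) * (‖x s‖ ^ 2 / (γ - K * ‖x s‖ ^ 2))
  have hU : ∀ s ∈ Ici (0 : ℝ), HasDerivWithinAt U
      (Real.exp (2 * γ * s) * (2 * γ) * (‖x s‖ ^ 2 / (γ - K * ‖x s‖ ^ 2)) + Real.exp (2 * γ * s) *
        ((2 * ⟪x s, x' s⟫ * (γ - K * ‖x s‖ ^ 2) - ‖x s‖ ^ 2 * (-(K * (2 * ⟪x s, x' s⟫)))) /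
          (γ - K * ‖x s‖ ^ 2) ^ 2)) (Ici 0) s := by
    intro s hs
    have h1 := (hx s hs).norm_sq
    have h2 := (h1.const_mul K).const_sub γ
    have h3 : HasDerivWithinAt (fun s => Real.exp (2 * γ * s)) (Real.exp (2 * γ * s) * (2 * γ))
        (Ici 0) s := by
      simpa using ((hasDerivAt_id s).const_mul (2 * γ)).exp.hasDerivWithinAt
    exact h3.mul (h1.div h2 (by linarith [hden s hs]))
  have hmono : U t ≤ U 0 := by
    refine image_le_of_deriv_right_le_deriv_boundary (a := 0) (b := t) (B := fun _ => U 0)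
      (B' := fun _ => 0)
      (fun s hs => ((hU s hs.1).continuousWithinAt).mono Icc_subset_Ici_self)
      (fun s hs => (hU s hs.1).mono (Ici_subset_Ici.mpr hs.1)) le_rfl continuousOn_const
      (fun s _ => hasDerivWithinAt_const _ _ _) (fun s hs => ?_) ⟨ht, le_rfl⟩
    have hD := hden s hs.1
    have hD0 : 0 < γ - K * ‖x s‖ ^ 2 := by linarith
    have hi := hin s hs.1
    have he := Real.exp_pos (2 * γ * s)
    have key : Real.exp (2 * γ * s) * (2 * γ) * (‖x s‖ ^ 2 / (γ - K * ‖x s‖ ^ 2)) +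
        Real.exp (2 * γ * s) *
        ((2 * ⟪x s, x' s⟫ * (γ - K * ‖x s‖ ^ 2) - ‖x s‖ ^ 2 * (-(K * (2 * ⟪x s, x' s⟫)))) /
          (γ - K * ‖x s‖ ^ 2) ^ 2) =
        Real.exp (2 * γ * s) * (2 * γ) / (γ - K * ‖x s‖ ^ 2) ^ 2 *
          (⟪x s, x' s⟫ - (-γ * ‖x s‖ ^ 2 + K * ‖x s‖ ^ 4)) := by
      field_simp
      ring
    rw [key]
    exact mul_nonpos_of_nonneg_of_nonpos (by positivity) (by linarith)
  -- The factor 2 comes from `γ / 2 ≤ γ - KV ≤ γ`: the upper bound is used at time `t`, the lower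
  -- one at time 0.
  have hVt : ‖x t‖ ^ 2 ≤ 2 * ‖x 0‖ ^ 2 * Real.exp (-γ * t) ^ 2 := by
    have hDt := hden t ht
    have hD0 := hden 0 le_rfl
    have h1 : ‖x t‖ ^ 2 / γ ≤ ‖x t‖ ^ 2 / (γ - K * ‖x t‖ ^ 2) :=
      div_le_div_of_nonneg_left (by positivity) (by linarith)
        (by have : 0 ≤ K * ‖x t‖ ^ 2 := by positivity
            linarith)
    have h2 : ‖x 0‖ ^ 2 / (γ - K * ‖x 0‖ ^ 2) ≤ ‖x 0‖ ^ 2 / (γ / 2) :=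
      div_le_div_of_nonneg_left (by positivity) (by linarith) hD0
    have h3 : Real.exp (2 * γ * t) * (‖x t‖ ^ 2 / γ) ≤ ‖x 0‖ ^ 2 / (γ / 2) := by
      have : U 0 = ‖x 0‖ ^ 2 / (γ - K * ‖x 0‖ ^ 2) := by simp [U]
      calc _ ≤ U t := by dsimp only [U]; gcongr
        _ ≤ _ := hmono.trans (this ▸ h2)
    have h4 : Real.exp (2 * γ * t) * Real.exp (-γ * t) ^ 2 = 1 := by
      rw [← Real.exp_nat_mul, ← Real.exp_add]; simp; ring
    have h5 : Real.exp (2 * γ * t) * ‖x t‖ ^ 2 ≤ 2 * ‖x 0‖ ^ 2 := by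
      have := mul_le_mul_of_nonneg_right h3 hγ.le
      field_simp at this
      linarith
    calc ‖x t‖ ^ 2 = (Real.exp (2 * γ * t) * ‖x t‖ ^ 2) * Real.exp (-γ * t) ^ 2 := by
          linear_combination (-‖x t‖ ^ 2) * h4
      _ ≤ _ := by gcongr
  refine le_of_sq_le_sq ?_ (by positivity)
  rw [mul_pow, mul_pow, Real.sq_sqrt (by norm_num)]
  exact hVt

/-- Forward solutions of a `C¹` field tangent to a subspace `S` exist for all times, if the field
points inwards along a sphere of `S` around the origin and the initial value lies in the ball. -/
theorem exists_forward_solution [FiniteDimensional ℝ F] {v : F → F} (hv : ContDiff ℝ 1 v)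
    {S : Submodule ℝ F} (hS : ∀ x, v x ∈ S) {r : ℝ} (hr : 0 < r)
    (hin : ∀ x ∈ S, ‖x‖ ^ 2 = r ^ 2 → ⟪x, v x⟫ < 0) {x₀ : F} (hx₀ : x₀ ∈ S)
    (h0 : ‖x₀‖ ^ 2 ≤ r ^ 2) :
    ∃ x : ℝ → F, x 0 = x₀ ∧ ∀ t ∈ Ici (0 : ℝ), HasDerivWithinAt x (v (x t)) (Ici 0) t := by
  -- The cutoff makes the field bounded and Lipschitz without changing it on the closed ball of
  -- radius `r`, where the solution turns out to remain.
  let χ : ContDiffBump (0 : F) := ⟨r, r + 1, hr, by linarith⟩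
  let g : F → F := fun x => χ x • v x
  have hg : ContDiff ℝ 1 g := χ.contDiff.smul hv
  have hgc : HasCompactSupport g := χ.hasCompactSupport.smul_right
  obtain ⟨K, hK⟩ := hg.lipschitzWith_of_hasCompactSupport hgc one_ne_zero
  obtain ⟨L, hL⟩ := hgc.exists_bound_of_continuous hg.continuous
  obtain ⟨x, hx0, hx⟩ := exists_global_solution_of_lipschitz_of_bounded (L := L.toNNReal) hK
    (fun y => (hL y).trans (Real.le_coe_toNNReal L)) x₀
  have hone : ∀ y : F, ‖y‖ ^ 2 ≤ r ^ 2 → g y = v y := by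
    intro y hy
    have : χ y = 1 := χ.one_of_mem_closedBall (by simpa using le_of_sq_le_sq hy hr.le)
    simp [g, this]
  have hxw : ∀ t ∈ Ici (0 : ℝ), HasDerivWithinAt x (g (x t)) (Ici 0) t := fun t _ =>
    (hx t).hasDerivWithinAt
  have hmem : ∀ t, 0 ≤ t → x t ∈ S := fun t ht =>
    mem_submodule_of_hasDerivWithinAt hxw (fun s _ => S.smul_mem _ (hS _)) (hx0 ▸ hx₀) ht
  have hball : ∀ t, 0 ≤ t → ‖x t‖ ^ 2 ≤ r ^ 2 := fun t ht =>
    norm_sq_le_of_inner_neg hxw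
      (fun s hs he => by rw [hone _ he.le]; exact hin _ (hmem s hs) he) (hx0 ▸ h0) ht
  exact ⟨x, hx0, fun t ht => hone _ (hball t ht) ▸ hxw t ht⟩

end Lyapunov

/-! ### Spectral gap of a positive semidefinite matrix -/

open Matrix in
/-- A nonzero positive semidefinite matrix has a smallest positive eigenvalue, and this eigenvalue
bounds the quadratic form from below on the orthogonal complement of the kernel. -/
theorem Matrix.PosSemidef.exists_isSmallestPosEigenvalue {ι : Type*} [Fintype ι] [DecidableEq ι]
    {A : Matrix ι ι ℝ} (hA : A.PosSemidef) (hne : A ≠ 0) :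
    ∃ γ : ℝ, Formation.IsSmallestPosEigenvalue A γ ∧
      ∀ x : EuclideanSpace ℝ ι, (∀ u : ι → ℝ, A *ᵥ u = 0 → u ⬝ᵥ x.ofLp = 0) →
        γ * ‖x‖ ^ 2 ≤ x.ofLp ⬝ᵥ A *ᵥ x.ofLp := by
  have hH := hA.isHermitian
  have heig : ∀ i, Module.End.HasEigenvalue (Matrix.toLin' A) (hH.eigenvalues i) := by
    intro i
    refine Module.End.hasEigenvalue_of_hasEigenvector (x := (hH.eigenvectorBasis i).ofLp)
      ⟨Module.End.mem_eigenspace_iff.mpr ?_, ?_⟩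
    · simpa using hH.mulVec_eigenvectorBasis i
    · intro h
      have := hH.eigenvectorBasis.orthonormal.ne_zero i
      exact this (WithLp.ofLp_injective 2 (by simpa using h))
  have hfin : {μ : ℝ | 0 < μ ∧ Module.End.HasEigenvalue (Matrix.toLin' A) μ}.Finite :=
    (Module.End.finite_hasEigenvalue (Matrix.toLin' A)).subset fun μ h => h.2
  have hnon : {μ : ℝ | 0 < μ ∧ Module.End.HasEigenvalue (Matrix.toLin' A) μ}.Nonempty := by
    by_contra h
    refine hne (hH.eigenvalues_eq_zero_iff.mp (funext fun i => ?_))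
    by_contra hi
    exact h ⟨_, lt_of_le_of_ne (hA.eigenvalues_nonneg i) (Ne.symm hi), heig i⟩
  obtain ⟨γ, hγ, hmin⟩ := Set.exists_min_image _ id hfin hnon
  refine ⟨γ, ⟨hγ, hmin⟩, fun x hx => ?_⟩
  have hexp : x.ofLp ⬝ᵥ A *ᵥ x.ofLp =
      ∑ i, hH.eigenvalues i * (inner ℝ (hH.eigenvectorBasis i) x) ^ 2 := by
    have h1 : x.ofLp ⬝ᵥ A *ᵥ x.ofLp = inner ℝ x (WithLp.toLp 2 (A *ᵥ x.ofLp)) := by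
      simp [EuclideanSpace.inner_eq_star_dotProduct, dotProduct_comm]
    rw [h1, ← hH.eigenvectorBasis.sum_inner_mul_inner]
    refine Finset.sum_congr rfl fun i _ => ?_
    have h2 : inner ℝ (hH.eigenvectorBasis i) (WithLp.toLp 2 (A *ᵥ x.ofLp)) =
        hH.eigenvalues i * inner ℝ (hH.eigenvectorBasis i) x := by
      have h3 := hH.mulVec_eigenvectorBasis i
      have hT : Aᵀ = A := by simpa using hH.eq
      simp only [EuclideanSpace.inner_eq_star_dotProduct, star_trivial]
      rw [dotProduct_comm, dotProduct_mulVec, ← mulVec_transpose, hT, h3, smul_dotProduct,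
        smul_eq_mul, dotProduct_comm]
    rw [h2, real_inner_comm x]
    ring
  rw [hexp, ← hH.eigenvectorBasis.sum_sq_inner_right x, Finset.mul_sum]
  refine Finset.sum_le_sum fun i _ => ?_
  -- An eigenvector for eigenvalue 0 lies in the kernel, so its component of `x` vanishes; every
  -- other eigenvalue is at least `γ`.
  rcases (hA.eigenvalues_nonneg i).eq_or_lt with h | h
  · have h0 := hx _ ((hH.mulVec_eigenvectorBasis i).trans (by rw [← h, zero_smul]))
    have h1 : inner ℝ (hH.eigenvectorBasis i) x = 0 := by
      rw [EuclideanSpace.inner_eq_star_dotProduct, star_trivial, dotProduct_comm]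
      exact h0
    rw [h1]; simp
  · exact mul_le_mul_of_nonneg_right (hmin _ ⟨h, heig i⟩) (sq_nonneg _)

/-! ### Coordinate formulas and the quadratic form of `F` -/

namespace Formation

open Matrix

section Formulas

variable {n d m : ℕ} {G : SimpleGraph (Fin n)} (E : EdgeLabelling G m)

theorem EdgeLabelling.adj (k : Fin m) : G.Adj (E.tail k) (E.head k) :=
  E.bijOn.mapsTo (Set.mem_univ k)

theorem incidence_mulVec (v : Fin n → ℝ) (k : Fin m) :
    (incidence E *ᵥ v) k = v (E.head k) - v (E.tail k) := by
  have hne : E.tail k ≠ E.head k := (E.adj k).ne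
  have h : ∀ i, incidence E k i * v i =
      (if i = E.head k then v i else 0) - (if i = E.tail k then v i else 0) := by
    intro i
    simp only [incidence, of_apply]
    split_ifs with h1 h2
    · exact absurd (h2.symm.trans h1) hne
    all_goals simp
  simp [mulVec, dotProduct, h, Finset.sum_sub_distrib]

theorem kronecker_one_mulVec {ι κ : Type*} [Fintype κ] (A : Matrix ι κ ℝ)
    (v : κ × Fin d → ℝ) (i : ι) (a : Fin d) :
    ((A ⊗ₖ (1 : Matrix (Fin d) (Fin d) ℝ)) *ᵥ v) (i, a) = (A *ᵥ fun j => v (j, a)) i := by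
  simp [mulVec, dotProduct, Fintype.sum_prod_type, kroneckerMap_apply, one_apply]

theorem relPos_apply (p : Config n d) (k : Fin m) (a : Fin d) :
    relPos E p (k, a) = p (E.head k, a) - p (E.tail k, a) := by
  rw [relPos, kronecker_one_mulVec, incidence_mulVec]

theorem rigidityMatrix_mulVec (p : Config n d) (v : Fin n × Fin d → ℝ) (k : Fin m) :
    (rigidityMatrix E p *ᵥ v) k = ∑ a, (p (E.head k, a) - p (E.tail k, a)) *
      (v (E.head k, a) - v (E.tail k, a)) := by
  rw [rigidityMatrix, ← mulVec_mulVec]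
  simp only [mulVec, dotProduct, transpose_apply, blockDiag, of_apply, Fintype.sum_prod_type,
    ite_mul, zero_mul]
  rw [Finset.sum_comm]
  simp only [Finset.sum_ite_eq', Finset.mem_univ, if_true]
  refine Finset.sum_congr rfl fun a _ => ?_
  rw [relPos_apply]
  congr 1
  refine Eq.trans ?_ ((kronecker_one_mulVec _ v k a).trans (incidence_mulVec E _ k))
  simp only [mulVec, dotProduct, Fintype.sum_prod_type]

theorem distError_apply (dist : Fin m → ℝ) (p : Config n d) (k : Fin m) :
    distError E dist p k =
      ∑ a, (p (E.head k, a) - p (E.tail k, a)) ^ 2 - dist k ^ 2 := by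
  simp [distError, EuclideanSpace.norm_sq_eq, agent]

variable (Go : SimpleGraph (Fin n)) [DecidableRel Go.Adj]

theorem orientationMatrix_mulVec (v : Fin n × Fin d → ℝ) (i : Fin n) (a : Fin d) :
    (orientationMatrix d Go *ᵥ v) (i, a) = (Go.lapMatrix ℝ *ᵥ fun j => v (j, a)) i :=
  kronecker_one_mulVec _ v i a

theorem orientationMatrix_transpose : (orientationMatrix d Go)ᵀ = orientationMatrix d Go := by
  rw [orientationMatrix, ← kroneckerMap_transpose, Go.isSymm_lapMatrix ℝ, transpose_one]

theorem posSemidef_orientationMatrix : (orientationMatrix d Go).PosSemidef :=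
  (SimpleGraph.posSemidef_lapMatrix ℝ Go).kronecker PosSemidef.one

theorem orientationMatrix_mulVec_eq_zero_iff (v : Fin n × Fin d → ℝ) :
    orientationMatrix d Go *ᵥ v = 0 ↔ ∀ i j, Go.Adj i j → ∀ a, v (i, a) = v (j, a) := by
  have h : orientationMatrix d Go *ᵥ v = 0 ↔
      ∀ a, Go.lapMatrix ℝ *ᵥ (fun j => v (j, a)) = 0 := by
    simp only [funext_iff, Prod.forall, orientationMatrix_mulVec, Pi.zero_apply]
    exact forall_comm
  simp only [h, SimpleGraph.lapMatrix_mulVec_eq_zero_iff_forall_adj]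
  exact ⟨fun h i j hij a => h a i j hij, fun h a i j hij => h i j hij a⟩

/-- The masking of non-orientation agents in `p̄` is invisible to the Laplacian. -/
theorem orientationMatrix_mulVec_pBar (pHat p : Config n d) :
    orientationMatrix d Go *ᵥ pBar Go pHat p = orientationMatrix d Go *ᵥ (p - pHat).ofLp := by
  rw [← sub_eq_zero, ← mulVec_sub, orientationMatrix_mulVec_eq_zero_iff]
  intro i j hij a
  simp [pBar, show ∃ l, Go.Adj i l from ⟨j, hij⟩, show ∃ l, Go.Adj j l from ⟨i, hij.symm⟩]

theorem posSemidef_matrixF (p : Config n d) : (matrixF E Go p).PosSemidef := by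
  refine PosSemidef.add ?_ (posSemidef_orientationMatrix Go)
  simpa using posSemidef_conjTranspose_mul_self (rigidityMatrix E p)

theorem dotProduct_matrixF_mulVec (p : Config n d) (v : Fin n × Fin d → ℝ) :
    v ⬝ᵥ matrixF E Go p *ᵥ v = ∑ k, (rigidityMatrix E p *ᵥ v) k ^ 2 +
      v ⬝ᵥ orientationMatrix d Go *ᵥ v := by
  rw [matrixF, add_mulVec, dotProduct_add, ← mulVec_mulVec, dotProduct_mulVec, vecMul_transpose]
  simp [dotProduct, sq]

/-- Both summands of `vᵀFv` are nonnegative, so its vanishing forces `Rv = 0`; what is left of `Fv =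
0` is then the Laplacian equation. -/
theorem matrixF_mulVec_eq_zero_iff (p : Config n d) (v : Fin n × Fin d → ℝ) :
    matrixF E Go p *ᵥ v = 0 ↔ rigidityMatrix E p *ᵥ v = 0 ∧ orientationMatrix d Go *ᵥ v = 0 := by
  constructor
  · intro h
    have h0 : v ⬝ᵥ matrixF E Go p *ᵥ v = 0 := by rw [h, dotProduct_zero]
    rw [dotProduct_matrixF_mulVec] at h0
    have h1 : 0 ≤ ∑ k, (rigidityMatrix E p *ᵥ v) k ^ 2 := Finset.sum_nonneg fun k _ => sq_nonneg _
    have h2 : 0 ≤ v ⬝ᵥ orientationMatrix d Go *ᵥ v := by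
      simpa using (posSemidef_orientationMatrix Go).dotProduct_mulVec_nonneg v
    have h3 : ∑ k, (rigidityMatrix E p *ᵥ v) k ^ 2 = 0 := by linarith
    have hR : rigidityMatrix E p *ᵥ v = 0 := by
      rw [Finset.sum_eq_zero_iff_of_nonneg fun k _ => sq_nonneg _] at h3
      exact funext fun k => pow_eq_zero_iff two_ne_zero |>.mp (h3 k (Finset.mem_univ k))
    refine ⟨hR, ?_⟩
    rwa [matrixF, add_mulVec, ← mulVec_mulVec, hR, mulVec_zero, zero_add] at h
  · rintro ⟨hR, hL⟩
    rw [matrixF, add_mulVec, ← mulVec_mulVec, hR, mulVec_zero, hL, zero_add]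

end Formulas

end Formation

/-! ### The kernel of `F` consists of translations -/

namespace Formation

open Matrix

section Kernel

variable {n d m : ℕ} {G : SimpleGraph (Fin n)} (E : EdgeLabelling G m)
  (Go : SimpleGraph (Fin n)) [DecidableRel Go.Adj]

/-- Infinitesimal rotations: the velocities `v_i = B p_i` for matrices `B` in a linear family. -/
def rotationMap {W : Type*} [AddCommGroup W] [Module ℝ W]
    (B : W →ₗ[ℝ] Matrix (Fin d) (Fin d) ℝ) (p : Config n d) :
    W →ₗ[ℝ] (Fin n × Fin d → ℝ) where
  toFun w ia := (B w *ᵥ fun b => p (ia.1, b)) ia.2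
  map_add' w w' := by ext; simp [add_mulVec]
  map_smul' r w := by ext; simp [smul_mulVec]

theorem dotProduct_mulVec_self_of_skew {B : Matrix (Fin d) (Fin d) ℝ} (hB : Bᵀ = -B)
    (z : Fin d → ℝ) : z ⬝ᵥ B *ᵥ z = 0 := by
  have h : z ⬝ᵥ B *ᵥ z = -(z ⬝ᵥ B *ᵥ z) := by
    conv_lhs => rw [dotProduct_mulVec, ← mulVec_transpose, hB, neg_mulVec, neg_dotProduct,
      dotProduct_comm]
  linarith

theorem rotationMap_sub {W : Type*} [AddCommGroup W] [Module ℝ W]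
    (B : W →ₗ[ℝ] Matrix (Fin d) (Fin d) ℝ) (p : Config n d) (w : W) (i j : Fin n) (a : Fin d) :
    rotationMap B p w (i, a) - rotationMap B p w (j, a) =
      (B w *ᵥ fun b => p (i, b) - p (j, b)) a := by
  have : (fun b => p (i, b) - p (j, b)) = (fun b => p (i, b)) - fun b => p (j, b) := rfl
  rw [this, mulVec_sub]
  rfl

/-- Each entry is `z_k · (B z_k)`, which vanishes by skew-symmetry. -/
theorem rigidityMatrix_mulVec_rotationMap {W : Type*} [AddCommGroup W] [Module ℝ W]
    {B : W →ₗ[ℝ] Matrix (Fin d) (Fin d) ℝ} (hB : ∀ w, (B w)ᵀ = -B w) (p : Config n d) (w : W) :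
    rigidityMatrix E p *ᵥ rotationMap B p w = 0 := by
  funext k
  rw [rigidityMatrix_mulVec]
  simp only [rotationMap_sub]
  exact dotProduct_mulVec_self_of_skew (hB w) _

/-- In an infinitesimally rigid framework, if no infinitesimal rotation fixes all orientation edges,
then the motions preserving the lengths of all edges and fixing the orientation edges are the
translations. -/
theorem exists_eq_translation_of_mulVec_eq_zero {W : Type*} [AddCommGroup W] [Module ℝ W]
    [FiniteDimensional ℝ W] {B : W →ₗ[ℝ] Matrix (Fin d) (Fin d) ℝ} (hB : ∀ w, (B w)ᵀ = -B w)
    (hW : Module.finrank ℝ W + d = d * (d + 1) / 2) {p : Config n d}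
    (hGo : ∀ w, (∀ i j, Go.Adj i j → (B w *ᵥ fun b => p (i, b) - p (j, b)) = 0) → w = 0)
    (hn : 0 < n) (hrigid : InfinitesimallyRigid E p) {v : Fin n × Fin d → ℝ}
    (hv : rigidityMatrix E p *ᵥ v = 0) (hv' : orientationMatrix d Go *ᵥ v = 0) :
    ∃ c : Fin d → ℝ, v = fun ia => c ia.2 := by
  have : Nonempty (Fin n) := ⟨⟨0, hn⟩⟩
  let T : (Fin d → ℝ) →ₗ[ℝ] (Fin n × Fin d → ℝ) := LinearMap.funLeft ℝ ℝ Prod.snd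
  let K := LinearMap.ker (rigidityMatrix E p).mulVecLin
  let K' := K ⊓ LinearMap.ker (orientationMatrix d Go).mulVecLin
  let ρ := rotationMap B p
  have hT : Module.finrank ℝ (LinearMap.range T) = d := by
    rw [LinearMap.finrank_range_of_inj
      (LinearMap.funLeft_injective_of_surjective ℝ ℝ _ Prod.snd_surjective)]
    simp
  have hfix : ∀ w, orientationMatrix d Go *ᵥ ρ w = 0 → w = 0 := by
    intro w hw
    rw [orientationMatrix_mulVec_eq_zero_iff] at hw
    exact hGo w fun i j hij => funext fun a => by
      rw [← rotationMap_sub]; exact sub_eq_zero.mpr (hw i j hij a)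
  have hρ : Module.finrank ℝ (LinearMap.range ρ) = Module.finrank ℝ W := by
    refine LinearMap.finrank_range_of_inj ((injective_iff_map_eq_zero ρ).mpr fun w hw => hfix w ?_)
    rw [hw, mulVec_zero]
  have hK : Module.finrank ℝ K = d * (d + 1) / 2 := by
    have h1 := LinearMap.finrank_range_add_finrank_ker (rigidityMatrix E p).mulVecLin
    have h2 := hrigid.2
    rw [Matrix.rank] at h2
    simp only [Module.finrank_fintype_fun_eq_card, Fintype.card_prod, Fintype.card_fin] at h1
    have : n * d = d * n := mul_comm _ _
    change _ + Module.finrank ℝ K = _ at h1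
    omega
  have hinf : LinearMap.range ρ ⊓ K' = ⊥ := by
    rw [eq_bot_iff]
    rintro _ ⟨⟨w, rfl⟩, -, hw⟩
    rw [hfix w (by simpa using hw), map_zero]
    exact Submodule.zero_mem _
  have hsup : LinearMap.range ρ ⊔ K' ≤ K := by
    refine sup_le ?_ inf_le_left
    rintro _ ⟨w, rfl⟩
    exact rigidityMatrix_mulVec_rotationMap E hB p w
  -- The rotations fill `d(d+1)/2 - d` dimensions of `K` and meet `K'` trivially, leaving at most
  -- `d` for `K'`. It is not needed that rotations and translations span `K`.
  have hK' : Module.finrank ℝ K' ≤ d := by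
    have h1 := Submodule.finrank_sup_add_finrank_inf_eq (LinearMap.range ρ) K'
    rw [hinf, finrank_bot, hρ] at h1
    have h2 := Submodule.finrank_mono hsup
    omega
  have hTK : LinearMap.range T ≤ K' := by
    rintro _ ⟨c, rfl⟩
    refine ⟨?_, ?_⟩
    · change rigidityMatrix E p *ᵥ T c = 0
      funext k
      rw [rigidityMatrix_mulVec]
      simp [T, LinearMap.funLeft_apply]
    · change orientationMatrix d Go *ᵥ T c = 0
      rw [orientationMatrix_mulVec_eq_zero_iff]
      intros
      rfl
  have heq := Submodule.eq_of_le_of_finrank_le hTK (hK'.trans hT.ge)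
  obtain ⟨c, hc⟩ : v ∈ LinearMap.range T := heq ▸ ⟨hv, hv'⟩
  exact ⟨c, hc.symm⟩

/-- The skew-symmetric matrices of the plane. -/
def planeSkew : ℝ →ₗ[ℝ] Matrix (Fin 2) (Fin 2) ℝ := LinearMap.toSpanSingleton ℝ _ !![0, -1; 1, 0]

theorem planeSkew_transpose (w : ℝ) : (planeSkew w)ᵀ = -planeSkew w := by
  ext i j; fin_cases i <;> fin_cases j <;> simp [planeSkew]

theorem eq_zero_of_planeSkew_mulVec {w : ℝ} {x : Fin 2 → ℝ} (hx : x ≠ 0)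
    (h : planeSkew w *ᵥ x = 0) : w = 0 := by
  by_contra hw
  refine hx (funext fun i => ?_)
  have h0 := congrFun h 0
  have h1 := congrFun h 1
  simp [planeSkew, mulVec, dotProduct, Fin.sum_univ_two, hw] at h0 h1
  fin_cases i <;> simp [h0, h1]

/-- The skew-symmetric matrices of space, `spaceSkew w` being the cross product with `w`. -/
def spaceSkew : (Fin 3 → ℝ) →ₗ[ℝ] Matrix (Fin 3) (Fin 3) ℝ where
  toFun w := !![0, -w 2, w 1; w 2, 0, -w 0; -w 1, w 0, 0]
  map_add' w w' := by
    ext i j; fin_cases i <;> fin_cases j <;> simp <;> ring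
  map_smul' r w := by
    ext i j; fin_cases i <;> fin_cases j <;> simp

theorem spaceSkew_transpose (w : Fin 3 → ℝ) : (spaceSkew w)ᵀ = -spaceSkew w := by
  ext i j; fin_cases i <;> fin_cases j <;> simp [spaceSkew]

theorem exists_eq_smul_of_spaceSkew_mulVec {w x : Fin 3 → ℝ} (hw : w ≠ 0)
    (h : spaceSkew w *ᵥ x = 0) : ∃ t : ℝ, x = t • w := by
  have h0 := congrFun h 0
  have h1 := congrFun h 1
  have h2 := congrFun h 2
  simp [spaceSkew, mulVec, dotProduct, Fin.sum_univ_three] at h0 h1 h2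
  have hs : w ⬝ᵥ w ≠ 0 := fun h => hw (dotProduct_self_eq_zero.mp h)
  simp only [dotProduct, Fin.sum_univ_three] at hs
  -- The scalar is the projection coefficient `(w·x)/(w·w)`; the coordinate identities are those of
  -- `w × (w × x) = (w·x) w - (w·w) x`, whose left side is zero.
  refine ⟨(w 0 * x 0 + w 1 * x 1 + w 2 * x 2) / (w 0 * w 0 + w 1 * w 1 + w 2 * w 2), ?_⟩
  ext i
  rw [Pi.smul_apply, smul_eq_mul, div_mul_eq_mul_div, eq_div_iff hs]
  fin_cases i <;> simp
  · linear_combination w 2 * h1 - w 1 * h2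
  · linear_combination w 0 * h2 - w 2 * h0
  · linear_combination w 1 * h0 - w 0 * h1

theorem eq_zero_of_spaceSkew_mulVec {w x y : Fin 3 → ℝ} (hxy : LinearIndependent ℝ ![x, y])
    (hx : spaceSkew w *ᵥ x = 0) (hy : spaceSkew w *ᵥ y = 0) : w = 0 := by
  by_contra hw
  obtain ⟨s, rfl⟩ := exists_eq_smul_of_spaceSkew_mulVec hw hx
  obtain ⟨t, rfl⟩ := exists_eq_smul_of_spaceSkew_mulVec hw hy
  rw [LinearIndependent.pair_iff] at hxy
  have h := hxy t (-s) (by module)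
  have hs : s = 0 := by linarith [h.2]
  have h' := hxy 1 0 (by simp [hs])
  exact one_ne_zero h'.1

/-- The skew matrices have dimension 1 in the plane and 3 in space, which is `d(d+1)/2 - d`. A
nonzero one is injective in the plane and has a line as kernel in space, hence one edge vector or
two independent ones. -/
theorem exists_eq_translation_of_matrixF_mulVec_eq_zero {p : Config n d}
    (hrigid : InfinitesimallyRigid E p) (hOrient : IsOrientationChoice G Go p)
    {v : Fin n × Fin d → ℝ} (hv : matrixF E Go p *ᵥ v = 0) :
    ∃ c : Fin d → ℝ, v = fun ia => c ia.2 := by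
  obtain ⟨hR, hL⟩ := (matrixF_mulVec_eq_zero_iff E Go p v).mp hv
  rcases hOrient with ⟨rfl, i, j, hij, hne, hE⟩ | ⟨rfl, i, j, k, hij, hik, hli, hE⟩
  · refine exists_eq_translation_of_mulVec_eq_zero E Go planeSkew_transpose (by simp)
      (fun w hw => ?_) i.pos hrigid hR hL
    refine eq_zero_of_planeSkew_mulVec ?_ (hw j i (by simp [hE, hij.ne, hij.ne']))
    intro h
    exact hne (by ext a; simpa [agent] using congrFun h a)
  · refine exists_eq_translation_of_mulVec_eq_zero E Go spaceSkew_transpose (by simp)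
      (fun w hw => ?_) i.pos hrigid hR hL
    refine eq_zero_of_spaceSkew_mulVec ?_ (hw j i (by simp [hE, hij.ne, hij.ne']))
      (hw k i (by simp [hE, hik.ne, hik.ne']))
    rw [LinearIndependent.pair_iff] at hli ⊢
    exact fun s t h => hli s t (by ext a; simpa [agent] using congrFun h a)

/-- This secures a positive eigenvalue: moving just one endpoint of an orientation edge is not in
the kernel of `F`. -/
theorem matrixF_ne_zero {p : Config n d} (hOrient : IsOrientationChoice G Go p) :
    matrixF E Go p ≠ 0 := by
  obtain ⟨i, j, a, hij⟩ : ∃ i j, ∃ _ : Fin d, Go.Adj i j := by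
    rcases hOrient with ⟨rfl, i, j, hij, -, hE⟩ | ⟨rfl, i, j, k, hij, -, -, hE⟩
    · exact ⟨i, j, 0, by simp [hE, hij.ne]⟩
    · exact ⟨i, j, 0, by simp [hE, hij.ne]⟩
  intro h
  have h0 : matrixF E Go p *ᵥ (fun ib => if ib.1 = i then 1 else 0) = 0 := by
    rw [h, zero_mulVec]
  have h1 := (orientationMatrix_mulVec_eq_zero_iff Go _).mp
    ((matrixF_mulVec_eq_zero_iff E Go p _).mp h0).2 i j hij a
  simp [hij.ne'] at h1

end Kernel

end Formation

/-! ### Centroid, smoothness and Lyapunov estimate of the closed loop -/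

namespace Formation

open Matrix

theorem translate_mem_desiredSet {n d m : ℕ} {G Go : SimpleGraph (Fin n)}
    {E : EdgeLabelling G m} {dist : Fin m → ℝ} {pHat pTilde : Config n d}
    (h : IsTarget E Go dist pHat pTilde)
    (c : EuclideanSpace ℝ (Fin d)) : translate pTilde c ∈ desiredSet E Go dist pHat := by
  have hag : ∀ i j, agent (translate pTilde c) i - agent (translate pTilde c) j =
      agent pTilde i - agent pTilde j := by
    intro i j; ext a; simp [agent, translate]
  refine ⟨?_, fun i j hij => (hag i j).trans (h.2 i j hij)⟩
  funext k
  rw [distError, hag, norm_sub_rev, h.1, sub_self, Pi.zero_apply]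

section ClosedLoop

variable {n d m : ℕ} {G : SimpleGraph (Fin n)} (E : EdgeLabelling G m)
  (Go : SimpleGraph (Fin n)) [DecidableRel Go.Adj]

/-- The configurations `1ₙ ⊗ c`. -/
def translations (n d : ℕ) : Submodule ℝ (Config n d) where
  carrier := {x | ∃ c : Fin d → ℝ, x.ofLp = fun ia => c ia.2}
  zero_mem' := ⟨0, rfl⟩
  add_mem' := by
    rintro x y ⟨c, hc⟩ ⟨c', hc'⟩
    exact ⟨c + c', by rw [WithLp.ofLp_add, hc, hc']; rfl⟩
  smul_mem' := by
    rintro r x ⟨c, hc⟩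
    exact ⟨r • c, by rw [WithLp.ofLp_smul, hc]; rfl⟩

theorem mem_orthogonal_translations {x : Config n d} :
    x ∈ (translations n d)ᗮ ↔ ∀ c : Fin d → ℝ, (fun ia => c ia.2) ⬝ᵥ x.ofLp = 0 := by
  rw [Submodule.mem_orthogonal]
  constructor
  · intro h c
    have := h (WithLp.toLp 2 fun ia => c ia.2) ⟨c, rfl⟩
    rwa [EuclideanSpace.inner_eq_star_dotProduct, star_trivial, dotProduct_comm] at this
  · rintro h u ⟨c, hc⟩
    rw [EuclideanSpace.inner_eq_star_dotProduct, star_trivial, dotProduct_comm, hc]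
    exact h c

/-- Every configuration has a translate of `p` from which it differs by a centred vector, and this
translate is the nearest one. -/
theorem exists_sub_translate_mem_orthogonal (p p₀ : Config n d) (c : EuclideanSpace ℝ (Fin d)) :
    ∃ c', p₀ - translate p c' ∈ (translations n d)ᗮ ∧
      ‖p₀ - translate p c'‖ ≤ ‖p₀ - translate p c‖ := by
  let y := p₀ - translate p c
  -- Shifting further by the orthogonal projection of `y` onto the translations removes that
  -- component and cannot increase the norm.
  obtain ⟨b, hb⟩ : (translations n d).starProjection y ∈ translations n d :=
    Submodule.starProjection_apply_mem _ y
  have hy : p₀ - translate p (c + WithLp.toLp 2 b) = y - (translations n d).starProjection y := by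
    ext ia
    rw [PiLp.sub_apply, PiLp.sub_apply, hb]
    simp only [y, translate, PiLp.sub_apply, PiLp.add_apply]
    ring
  refine ⟨c + WithLp.toLp 2 b, hy ▸ Submodule.sub_starProjection_mem_orthogonal y, ?_⟩
  rw [hy, ← Submodule.starProjection_orthogonal_val]
  exact Submodule.norm_starProjection_apply_le _ y

theorem contDiff_rigidityMatrix_apply (k : Fin m) (ia : Fin n × Fin d) :
    ContDiff ℝ 1 fun p : Config n d => rigidityMatrix E p k ia := by
  simp only [rigidityMatrix, mul_apply, transpose_apply]
  refine ContDiff.sum fun lb _ => ContDiff.mul ?_ contDiff_const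
  simp only [blockDiag, of_apply]
  split_ifs
  · simp only [relPos, mulVec, dotProduct]
    fun_prop
  · exact contDiff_const

theorem contDiff_closedLoop (dist : Fin m → ℝ) (pHat : Config n d) :
    ContDiff ℝ 1 (closedLoop E Go dist pHat) := by
  rw [contDiff_euclidean]
  intro ia
  simp only [closedLoop, orientationMatrix_mulVec_pBar, Pi.sub_apply, Pi.neg_apply]
  refine ContDiff.sub (ContDiff.neg ?_) ?_
  · simp only [mulVec, dotProduct, transpose_apply]
    refine ContDiff.sum fun k _ => (contDiff_rigidityMatrix_apply E k ia).mul ?_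
    simp only [distError_apply]
    fun_prop
  · simp only [mulVec, dotProduct, WithLp.ofLp_sub, Pi.sub_apply]
    fun_prop

theorem inner_closedLoop (dist : Fin m → ℝ) (pHat p x : Config n d) :
    inner ℝ x (closedLoop E Go dist pHat p) =
      -∑ k, (rigidityMatrix E p *ᵥ x.ofLp) k * distError E dist p k -
        x.ofLp ⬝ᵥ orientationMatrix d Go *ᵥ (p - pHat).ofLp := by
  rw [EuclideanSpace.inner_eq_star_dotProduct, star_trivial, dotProduct_comm, closedLoop,
    orientationMatrix_mulVec_pBar, dotProduct_sub, dotProduct_neg, dotProduct_mulVec,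
    vecMul_transpose]
  rfl

/-- The closed loop preserves the centroid. -/
theorem closedLoop_mem_orthogonal (dist : Fin m → ℝ) (pHat p : Config n d) :
    closedLoop E Go dist pHat p ∈ (translations n d)ᗮ := by
  rw [Submodule.mem_orthogonal]
  rintro u ⟨c, hc⟩
  have hL : orientationMatrix d Go *ᵥ u.ofLp = 0 := by
    rw [orientationMatrix_mulVec_eq_zero_iff, hc]
    intros; rfl
  rw [inner_closedLoop, dotProduct_mulVec, ← mulVec_transpose, orientationMatrix_transpose, hL]
  simp [rigidityMatrix_mulVec, hc]

variable {E Go} {dist : Fin m → ℝ} {pHat pTilde : Config n d}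

/-- Since `(s - t)² ≤ 2(s² + t²)`, and for `i ≠ j` the two agents occupy disjoint coordinate blocks
of `x`. -/
theorem sum_sq_sub_le (x : Config n d) {i j : Fin n} (hij : i ≠ j) :
    ∑ a, (x (i, a) - x (j, a)) ^ 2 ≤ 2 * ‖x‖ ^ 2 := by
  have h1 : ∑ a, (x (i, a) - x (j, a)) ^ 2 ≤ 2 * (∑ a, x (i, a) ^ 2 + ∑ a, x (j, a) ^ 2) := by
    rw [← Finset.sum_add_distrib, Finset.mul_sum]
    exact Finset.sum_le_sum fun a _ => by nlinarith [sq_nonneg (x (i, a) + x (j, a))]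
  have h2 : ∑ a, x (i, a) ^ 2 + ∑ a, x (j, a) ^ 2 ≤ ‖x‖ ^ 2 := by
    rw [EuclideanSpace.norm_sq_eq, Fintype.sum_prod_type,
      ← Finset.sum_pair (f := fun l => ∑ a, x (l, a) ^ 2) hij]
    simp only [Real.norm_eq_abs, sq_abs]
    exact Finset.sum_le_univ_sum_of_nonneg fun l => Finset.sum_nonneg fun a _ => sq_nonneg _
  linarith

/-- The Lyapunov estimate around a translate of the target. -/
theorem inner_closedLoop_le (h : IsTarget E Go dist pHat pTilde) (c : EuclideanSpace ℝ (Fin d))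
    (x : Config n d) :
    inner ℝ x (closedLoop E Go dist pHat (translate pTilde c + x)) ≤
      -(x.ofLp ⬝ᵥ matrixF E Go pTilde *ᵥ x.ofLp) + 5 * m * ‖x‖ ^ 4 := by
  -- By the orientation constraints `p̃ + 1 ⊗ c - p̂` agrees at the two ends of each orientation
  -- edge, so it lies in the kernel of the Laplacian.
  have hL : orientationMatrix d Go *ᵥ (translate pTilde c + x - pHat).ofLp =
      orientationMatrix d Go *ᵥ x.ofLp := by
    rw [← sub_eq_zero, ← mulVec_sub, orientationMatrix_mulVec_eq_zero_iff]
    intro i j hij a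
    have := congrArg (fun z : EuclideanSpace ℝ (Fin d) => z a) (h.2 i j hij)
    simp only [agent, PiLp.sub_apply] at this
    simp only [translate, WithLp.ofLp_sub, WithLp.ofLp_add, Pi.sub_apply, Pi.add_apply]
    linarith
  have hk : ∀ k, (rigidityMatrix E pTilde *ᵥ x.ofLp) k ^ 2 - 5 * ‖x‖ ^ 4 ≤
      (rigidityMatrix E (translate pTilde c + x) *ᵥ x.ofLp) k *
        distError E dist (translate pTilde c + x) k := by
    intro k
    let a := (rigidityMatrix E pTilde *ᵥ x.ofLp) k
    let b := ∑ l, (x (E.head k, l) - x (E.tail k, l)) ^ 2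
    have hR : (rigidityMatrix E (translate pTilde c + x) *ᵥ x.ofLp) k = a + b := by
      simp only [a, b, rigidityMatrix_mulVec, ← Finset.sum_add_distrib]
      refine Finset.sum_congr rfl fun l _ => ?_
      simp only [translate, WithLp.ofLp_add, Pi.add_apply]
      ring
    have he : distError E dist (translate pTilde c + x) k = 2 * a + b := by
      have h0 : distError E dist pTilde k = 0 := by
        rw [distError, norm_sub_rev, h.1, sub_self]
      rw [← sub_zero (distError E dist _ k), ← h0, distError_apply, distError_apply,
        sub_sub_sub_cancel_right]
      simp only [a, b, rigidityMatrix_mulVec, ← Finset.sum_add_distrib, ← Finset.sum_sub_distrib,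
        Finset.mul_sum]
      refine Finset.sum_congr rfl fun l _ => ?_
      simp only [translate, WithLp.ofLp_add, Pi.add_apply]
      ring
    have hb0 : 0 ≤ b := Finset.sum_nonneg fun l _ => sq_nonneg _
    have hb : b ≤ 2 * ‖x‖ ^ 2 := sum_sq_sub_le x (E.adj k).ne'
    rw [hR, he]
    change a ^ 2 - _ ≤ _
    -- `(a + b)(2a + b) - a² = (2a + 3b)²/4 - 5b²/4`, and `b² ≤ 4‖x‖⁴` gives the constant 5.
    nlinarith [sq_nonneg (2 * a + 3 * b), mul_self_le_mul_self hb0 hb]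
  have hsum := Finset.sum_le_sum fun k (_ : k ∈ Finset.univ) => hk k
  rw [Finset.sum_sub_distrib, Finset.sum_const, Finset.card_univ, Fintype.card_fin,
    nsmul_eq_mul] at hsum
  rw [inner_closedLoop, hL, dotProduct_matrixF_mulVec]
  linarith

end ClosedLoop

end Formation

/-! ### Exponential convergence -/

theorem theorem3 {n d m : ℕ} {G : SimpleGraph (Fin n)} (E : Formation.EdgeLabelling G m)
    (Go : SimpleGraph (Fin n)) [DecidableRel Go.Adj]
    (dist : Fin m → ℝ) (pHat pTilde : Formation.Config n d)
    (hTarget : Formation.IsTarget E Go dist pHat pTilde)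
    (hRigid : Formation.InfinitesimallyRigid E pTilde)
    (hOrient : Formation.IsOrientationChoice G Go pTilde) :
    ∃ γ : ℝ, Formation.IsSmallestPosEigenvalue (Formation.matrixF E Go pTilde) γ ∧
      ∃ δ > (0 : ℝ), ∃ C > (0 : ℝ), ∀ p₀ : Formation.Config n d,
        (∃ c : EuclideanSpace ℝ (Fin d), ‖p₀ - Formation.translate pTilde c‖ < δ) →
          (∃ p : ℝ → Formation.Config n d, Formation.IsSolution E Go dist pHat p₀ p) ∧
          ∀ p : ℝ → Formation.Config n d, Formation.IsSolution E Go dist pHat p₀ p →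
            ∃ pStar ∈ Formation.desiredSet E Go dist pHat,
              (∃ c : EuclideanSpace ℝ (Fin d), pStar = Formation.translate pTilde c) ∧
              ∀ t : ℝ, 0 ≤ t →
                ‖p t - pStar‖ ≤ C * ‖p₀ - pStar‖ * Real.exp (-γ * t) := by

  obtain ⟨γ, hγ, hquad⟩ := (Formation.posSemidef_matrixF E Go pTilde).exists_isSmallestPosEigenvalue
    (Formation.matrixF_ne_zero E Go hOrient)
  have hγ0 : 0 < γ := hγ.1.1
  -- The summand 1 makes `K` positive without appeal to `m > 0`.
  let K : ℝ := 5 * m + 1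
  have hK : 0 < K := by positivity
  have hlyap : ∀ c, ∀ x ∈ (Formation.translations n d)ᗮ,
      inner ℝ x (Formation.closedLoop E Go dist pHat (Formation.translate pTilde c + x)) ≤
        -γ * ‖x‖ ^ 2 + K * ‖x‖ ^ 4 := by
    intro c x hx
    have h1 := hquad x fun u hu => by
      obtain ⟨b, rfl⟩ :=
        Formation.exists_eq_translation_of_matrixF_mulVec_eq_zero E Go hRigid hOrient hu
      exact Formation.mem_orthogonal_translations.mp hx b
    have h2 := Formation.inner_closedLoop_le hTarget c x
    have h3 : 0 ≤ ‖x‖ ^ 4 := by positivity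
    simp only [K]
    linarith
  have hc : 0 < γ / (2 * K) := by positivity
  refine ⟨γ, hγ, √(γ / (2 * K)), Real.sqrt_pos.mpr hc, √2, by positivity, ?_⟩
  rintro p₀ ⟨c₀, hc₀⟩
  -- The given translate need not share the centroid of `p₀`; the nearest translate does, and is
  -- also within `δ`.
  obtain ⟨c, hmem, hle⟩ := Formation.exists_sub_translate_mem_orthogonal pTilde p₀ c₀
  have h0 : ‖p₀ - Formation.translate pTilde c‖ ^ 2 ≤ γ / (2 * K) := by
    rw [← Real.sq_sqrt hc.le]
    have := hle.trans hc₀.le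
    gcongr
  let v : Formation.Config n d → Formation.Config n d := fun x =>
    Formation.closedLoop E Go dist pHat (Formation.translate pTilde c + x)
  refine ⟨?_, fun p hp => ⟨_, Formation.translate_mem_desiredSet hTarget c, ⟨c, rfl⟩, ?_⟩⟩
  · have hv : ContDiff ℝ 1 v :=
      (Formation.contDiff_closedLoop E Go dist pHat).comp (contDiff_const.add contDiff_id)
    obtain ⟨x, hx0, hx⟩ := exists_forward_solution hv
      (fun x => Formation.closedLoop_mem_orthogonal E Go dist pHat _) (Real.sqrt_pos.mpr hc)
      (fun x hx he => (hlyap c x hx).trans_lt (by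
        rw [Real.sq_sqrt hc.le] at he
        have h4 : ‖x‖ ^ 4 = (‖x‖ ^ 2) ^ 2 := by ring
        have h5 : -γ * (γ / (2 * K)) + K * (γ / (2 * K)) ^ 2 = -(γ * γ / (4 * K)) := by
          field_simp; ring
        rw [h4, he, h5]
        exact neg_lt_zero.mpr (by positivity))) hmem (by rwa [Real.sq_sqrt hc.le])
    exact ⟨fun t => Formation.translate pTilde c + x t, by simp [hx0],
      fun t ht => (hx t ht).const_add _⟩
  -- The decay estimate applies to any solution, so uniqueness is not needed.
  · have hx : ∀ t ∈ Set.Ici (0 : ℝ), HasDerivWithinAt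
        (fun t => p t - Formation.translate pTilde c)
        (Formation.closedLoop E Go dist pHat (p t)) (Set.Ici 0) t :=
      fun t ht => (hp.2 t ht).sub_const _
    intro t ht
    have h0' : ‖p 0 - Formation.translate pTilde c‖ ^ 2 ≤ γ / (2 * K) := by rwa [hp.1]
    have := norm_le_exp_of_inner_le hγ0 hK hx (fun s hs => ?_) h0' ht
    · simpa only [hp.1] using this
    · have hS := mem_submodule_of_hasDerivWithinAt hx
        (fun s _ => Formation.closedLoop_mem_orthogonal E Go dist pHat _) (hp.1 ▸ hmem) hs
      simpa using hlyap c _ hS
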